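/- **Theorem 1.4.** Let $L^2(0,1)$ be the real Hilbert space of square-integrable functions. Let $\mathscr W_1^0=\{q\in L^2(0,1): q'\in L^2(0,1),\ q(0)=q(1)=0\}$ (absolutely continuous functions on $[0,1]$ with derivative in $L^2(0,1)$, vanishing at the end points) with norm $\|q\|_{\mathscr W_1^0}=\|q'\|_{L^2(0,1)}$, and let $\mathscr H_0=\{f\in L^2(0,1):\int_0^1 f\,dx=0\}$ with the $L^2$ norm. Fix $q_0\in\mathbb R$. For $q\in\mathscr W_1^0$ and $r_0>0$ consider the surface of revolution with metric $(dx)^2+r(x)^2(d\theta)^2$, $0\le x\le 1$, with profile $$r(x)=r_0e^{2Q(x)},\qquad Q(x)=\int_0^x(q_0+q(t))\,dt,$$ let $\mathcal K=-r''/r$ be its Gaussian curvature (defined almost everywhere), and put $\mathcal K_0=4\int_0^1(2q_0q+q^2)\,dx$. Then $$G(q):=-\mathcal K-\mathcal K_0-4q_0^2=2q'+4(q_0+q)^2-\mathcal K_0-4q_0^2$$ belongs to $\mathscr H_0$ and does not depend on $r_0$, and the mapping $G:\mathscr W_1^0\to\mathscr H_0$ is a real-analytic isomorphism between $\mathscr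 W_1^0$ and $\mathscr H_0$, i.e. $G$ is a bijection and both $G$ and $G^{-1}$ are real analytic. Moreover, for fixed $q_0$, the constant $\mathcal K_0$ is uniquely determined by $G(q)$: there is a unique function $k:\mathscr H_0\to\mathbb R$ with $k(G(q))=\mathcal K_0$ for all $q\in\mathscr W_1^0$. -/

import Mathlib

open MeasureTheory Set

noncomputable section

namespace Revolution

/-- Lebesgue measure on the interval `(0,1)`. -/
abbrev unitMeasure : Measure ℝ := volume.restrict (Ioo (0 : ℝ) 1)

/-- The real Hilbert space `L²(0,1)`. -/
abbrev L2 : Type := Lp ℝ 2 unitMeasure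

/-- The space `𝓗₀` of mean-zero functions in `L²(0,1)`. -/
def H0 : Submodule ℝ L2 where
  carrier := {f | ∫ x, f x ∂unitMeasure = 0}
  add_mem' := by
    intro f g hf hg
    have e : ∫ x, (f + g : L2) x ∂unitMeasure = ∫ x, (f x + g x) ∂unitMeasure :=
      integral_congr_ae (Lp.coeFn_add f g)
    simp only [mem_ofPred_eq] at *
    rw [e, integral_add ((Lp.memLp f).integrable one_le_two)
      ((Lp.memLp g).integrable one_le_two), hf, hg, add_zero]
  zero_mem' := by
    have e : ∫ x, (0 : L2) x ∂unitMeasure = ∫ _, (0 : ℝ) ∂unitMeasure :=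
      integral_congr_ae (Lp.coeFn_zero ℝ 2 unitMeasure)
    simpa using e
  smul_mem' := by
    intro c f hf
    have e : ∫ x, (c • f : L2) x ∂unitMeasure = ∫ x, c * f x ∂unitMeasure :=
      integral_congr_ae (Lp.coeFn_smul c f)
    simp only [mem_ofPred_eq] at *
    rw [e, integral_const_mul, hf, mul_zero]

theorem ae_diff {q : ℝ → ℝ} (h : AbsolutelyContinuousOnInterval q 0 1) :
    ∀ᵐ x ∂unitMeasure, DifferentiableAt ℝ q x := by
  refine (ae_restrict_iff' measurableSet_Ioo).2 ?_
  filter_upwards [h.ae_differentiableAt] with x hx hx'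
  exact hx (by rw [uIcc_of_le zero_le_one]; exact Ioo_subset_Icc_self hx')

theorem deriv_add_ae {p q : ℝ → ℝ} (hp : AbsolutelyContinuousOnInterval p 0 1)
    (hq : AbsolutelyContinuousOnInterval q 0 1) :
    deriv (p + q) =ᵐ[unitMeasure] deriv p + deriv q := by
  filter_upwards [ae_diff hp, ae_diff hq] with x h1 h2
  exact deriv_add h1 h2

theorem deriv_smul_ae (c : ℝ) {q : ℝ → ℝ} (hq : AbsolutelyContinuousOnInterval q 0 1) :
    deriv (c • q) =ᵐ[unitMeasure] c • deriv q := by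
  filter_upwards [ae_diff hq] with x h
  exact deriv_const_smul c h

/-- The vector space underlying `𝓦₁⁰`: absolutely continuous functions on `[0,1]` with derivative
in `L²(0,1)` and `q(0) = q(1) = 0`. A function on `[0,1]` vanishing at the end points
is represented by its extension by zero to the line. -/
def W10Sub : Submodule ℝ (ℝ → ℝ) where
  carrier := {q | AbsolutelyContinuousOnInterval q 0 1 ∧ MemLp (deriv q) 2 unitMeasure ∧
    ∀ x, x ∉ Ioo (0 : ℝ) 1 → q x = 0}
  add_mem' := by
    rintro p q ⟨h1, h2, h3⟩ ⟨k1, k2, k3⟩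
    refine ⟨h1.add k1, (memLp_congr_ae (deriv_add_ae h1 k1)).2 (h2.add k2), fun x hx => ?_⟩
    simp [h3 x hx, k3 x hx]
  zero_mem' := by
    refine ⟨?_, ?_, fun x _ => rfl⟩
    · exact ((LipschitzWith.const (0 : ℝ)).lipschitzOnWith
        (s := uIcc (0 : ℝ) 1)).absolutelyContinuousOnInterval
    · have : deriv (0 : ℝ → ℝ) = fun _ => 0 := by
        funext x; exact deriv_const x (0 : ℝ)
      rw [this]; exact MemLp.zero
  smul_mem' := by
    rintro c q ⟨h1, h2, h3⟩
    refine ⟨h1.const_smul c, (memLp_congr_ae (deriv_smul_ae c h1)).2 (h2.const_smul c),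
      fun x hx => ?_⟩
    simp [h3 x hx]

/-- The space `𝓦₁⁰`, which carries the norm `‖q‖ = ‖q'‖_{L²(0,1)}` (see the instances below). -/
def W10 : Type := W10Sub

instance : AddCommGroup W10 := inferInstanceAs (AddCommGroup W10Sub)

instance : Module ℝ W10 := inferInstanceAs (Module ℝ W10Sub)

instance : CoeFun W10 (fun _ => ℝ → ℝ) := ⟨fun q => q.1⟩

/-- The derivative as a linear map `𝓦₁⁰ → L²(0,1)`. -/
def W10.D : W10 →ₗ[ℝ] L2 where
  toFun q := q.2.2.1.toLp (deriv q)
  map_add' p q := by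
    rw [← MemLp.toLp_add]
    exact MemLp.toLp_congr _ _ (deriv_add_ae p.2.1 q.2.1)
  map_smul' c q := by
    rw [RingHom.id_apply, ← MemLp.toLp_const_smul]
    exact MemLp.toLp_congr _ _ (deriv_smul_ae c q.2.1)

theorem W10.D_injective : Function.Injective W10.D := by
  rw [injective_iff_map_eq_zero]
  intro q hq
  have h0 : deriv q =ᵐ[unitMeasure] 0 := by
    have h1 := q.2.2.1.coeFn_toLp
    have h2 : (q.2.2.1.toLp (deriv q) : L2) = 0 := hq
    rw [h2] at h1
    exact h1.symm.trans (Lp.coeFn_zero ℝ 2 unitMeasure)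
  apply Subtype.ext
  funext x
  change q x = 0
  by_cases hx : x ∈ Ioo (0 : ℝ) 1
  · have hac : AbsolutelyContinuousOnInterval q 0 x := q.2.1.mono (by
      rw [uIcc_of_le zero_le_one, uIcc_of_le hx.1.le]
      exact Icc_subset_Icc_right hx.2.le)
    have h := hac.integral_deriv_eq_sub
    have hz : ∫ t in (0 : ℝ)..x, deriv q t = 0 := by
      rw [intervalIntegral.integral_of_le hx.1.le, integral_Ioc_eq_integral_Ioo]
      apply integral_eq_zero_of_ae
      exact ae_restrict_of_ae_restrict_of_subset (Ioo_subset_Ioo_right hx.2.le) h0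
    have hq0 : q 0 = 0 := q.2.2.2 0 (by simp)
    linarith
  · exact q.2.2.2 x hx

instance : NormedAddCommGroup W10 :=
  NormedAddCommGroup.induced W10 L2 W10.D W10.D_injective

instance : NormedSpace ℝ W10 := NormedSpace.induced ℝ W10 L2 W10.D

/-- The profile `r(x) = r₀ e^{2Q(x)}`, `Q(x) = ∫₀ˣ (q₀ + q(t)) dt`. -/
def profile (r₀ q₀ : ℝ) (q : W10) (x : ℝ) : ℝ :=
  r₀ * Real.exp (2 * ∫ t in (0 : ℝ)..x, (q₀ + q t))

/-- The Gaussian curvature `-r''/r` of the surface of revolution with metric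
`(dx)² + r(x)² (dθ)²`. -/
def gaussianCurvature (r : ℝ → ℝ) (x : ℝ) : ℝ := -(deriv (deriv r) x / r x)

/-- The constant `𝒦₀ = 4 ∫₀¹ (2 q₀ q + q²) dx`. -/
def K0 (q₀ : ℝ) (q : W10) : ℝ := 4 * ∫ x in (0 : ℝ)..1, (2 * q₀ * q x + q x ^ 2)

/-- A real-analytic isomorphism between real normed spaces: a bijection that is real analytic
everywhere together with its inverse. -/
def IsRealAnalyticIso {E F : Type*} [NormedAddCommGroup E] [NormedSpace ℝ E]
    [NormedAddCommGroup F] [NormedSpace ℝ F] (f : E → F) : Prop :=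
  AnalyticOnNhd ℝ f univ ∧
    ∃ g : F → E, Function.LeftInverse g f ∧ Function.RightInverse g f ∧ AnalyticOnNhd ℝ g univ

end Revolution

end

/-!
Let `P` be the projection `f ↦ f - ∫ f` of `L²(0,1)` onto `𝓗₀`. Since `∫ q' = 0`, the curvature map
is the quadratic polynomial `G q = P (2 q' + 8 q₀ q + 4 q²)` (`curvMap`), so it is analytic. Put
`L p h = P (2 h' + 8 (q₀ + p) h)` (`linOp`). Because `G` is quadratic, the same operator gives the
derivative, `dG(q) = L q`, and the finite differences,
`G p - G q = L ((p + q) / 2) (p - q)` (`curvMap_sub`).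

The equation `L p h = g` says `h' + a h = g / 2 + m` with `a = 4 (q₀ + p)`, an unknown constant `m`
and `h(0) = h(1) = 0`. With the integrating factor `E = exp (∫₀ˣ a)` the solution is
`E h = ∫₀ˣ E (g / 2 + m)`, and `h(1) = 0` fixes `m`. Hence every `L p` is bijective
(`linOp_surjective`), and `‖h‖ ≤ C ‖L p h‖` with `C` depending only on a bound for `‖p‖`
(`exists_norm_le_linOp`). It follows that:

* `G` is injective, by the difference formula;
* `G` is a local analytic isomorphism with open range, by the inverse function theorem;
* the range of `G` is closed (`isClosed_range_curvMap`). Pairing `G q` with `q'` gives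
  `2 ‖q‖² = ⟪G q, q'⟫`, because `q'`, `q q'` and `q² q'` have zero integral; hence
  `2 ‖q‖ ≤ ‖G q‖` (`two_mul_norm_le_norm_curvMap`). If `G qₙ` converges, then `qₙ` is bounded, and
  by the difference formula and the uniform estimate on `L` it is a Cauchy sequence.

As `𝓗₀` is connected, `G` is onto, and its inverse is locally the analytic inverse given by the
inverse function theorem. Since `G` is bijective, `𝒦₀` is a function of `G q`, and only one.
-/

namespace Revolution

/-! ### Functions on the unit interval -/

theorem _root_.AbsolutelyContinuousOnInterval.congr {f g : ℝ → ℝ} {a b : ℝ}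
    (hf : AbsolutelyContinuousOnInterval f a b) (h : EqOn f g (uIcc a b)) :
    AbsolutelyContinuousOnInterval g a b := by
  rw [absolutelyContinuousOnInterval_iff] at hf ⊢
  intro ε hε
  obtain ⟨δ, hδ, H⟩ := hf ε hε
  refine ⟨δ, hδ, fun E hE hlt => ?_⟩
  have := H E hE hlt
  convert this using 1
  refine Finset.sum_congr rfl fun i hi => ?_
  rw [h (hE.1 i hi).1, h (hE.1 i hi).2]

instance : IsProbabilityMeasure unitMeasure := ⟨by simp⟩

theorem integral_unitMeasure_eq (f : ℝ → ℝ) :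
    ∫ x, f x ∂unitMeasure = ∫ x in (0 : ℝ)..1, f x := by
  rw [intervalIntegral.integral_of_le zero_le_one, integral_Ioc_eq_integral_Ioo]

theorem intervalIntegrable_of_integrable {f : ℝ → ℝ} (hf : Integrable f unitMeasure) :
    IntervalIntegrable f volume 0 1 :=
  (intervalIntegrable_iff_integrableOn_Ioo_of_le zero_le_one).2 hf

theorem intervalIntegral_congr_unit {f g : ℝ → ℝ} (h : f =ᵐ[unitMeasure] g) {x : ℝ}
    (hx : x ∈ Icc (0 : ℝ) 1) : ∫ t in (0 : ℝ)..x, f t = ∫ t in (0 : ℝ)..x, g t := by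
  rw [intervalIntegral.integral_of_le hx.1, intervalIntegral.integral_of_le hx.1,
    integral_Ioc_eq_integral_Ioo, integral_Ioc_eq_integral_Ioo]
  exact integral_congr_ae
    (ae_restrict_of_ae_restrict_of_subset (Ioo_subset_Ioo_right hx.2) h)

theorem abs_intervalIntegral_le {f : ℝ → ℝ} (hf : Integrable f unitMeasure) {x : ℝ}
    (hx : x ∈ Icc (0 : ℝ) 1) : |∫ t in (0 : ℝ)..x, f t| ≤ ∫ t, |f t| ∂unitMeasure := by
  rw [intervalIntegral.integral_of_le hx.1, integral_Ioc_eq_integral_Ioo]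
  refine abs_integral_le_integral_abs.trans ?_
  exact setIntegral_mono_set hf.abs (Filter.Eventually.of_forall fun _ => abs_nonneg _)
    (Ioo_subset_Ioo_right hx.2).eventuallyLE

theorem integral_abs_le_norm (f : L2) : ∫ x, |f x| ∂unitMeasure ≤ ‖f‖ := by
  have h1 : ∫ x, |f x| ∂unitMeasure = (eLpNorm f 1 unitMeasure).toReal := by
    simp_rw [← Real.norm_eq_abs]
    rw [integral_norm_eq_lintegral_enorm (Lp.aestronglyMeasurable f),
      eLpNorm_one_eq_lintegral_enorm]
  rw [h1, Lp.norm_def]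
  exact ENNReal.toReal_mono (Lp.eLpNorm_ne_top f)
    (eLpNorm_le_eLpNorm_of_exponent_le one_le_two (Lp.aestronglyMeasurable f))

theorem norm_le_of_ae_abs_le {f : L2} {C : ℝ} (hC : 0 ≤ C) (h : ∀ᵐ x ∂unitMeasure, |f x| ≤ C) :
    ‖f‖ ≤ C :=
  (Lp.norm_le_of_ae_bound hC h).trans_eq (by simp [measureUnivNNReal])

theorem L2.integrable (f : L2) : Integrable f unitMeasure :=
  (Lp.memLp f).integrable one_le_two

/-! ### Mean value and the projection onto mean-zero functions -/

/-- The mean value as a continuous linear functional on `L²(0,1)`. -/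
noncomputable def mean : L2 →L[ℝ] ℝ :=
  LinearMap.mkContinuous
    { toFun := fun f => ∫ x, f x ∂unitMeasure
      map_add' := fun f g => by
        rw [integral_congr_ae (Lp.coeFn_add f g)]
        exact integral_add (L2.integrable f) (L2.integrable g)
      map_smul' := fun c f => by
        rw [integral_congr_ae (Lp.coeFn_smul c f)]
        exact integral_const_mul c _ } 1
    fun f => by
      rw [one_mul]
      exact (norm_integral_le_integral_norm _).trans (integral_abs_le_norm f)

theorem mean_apply (f : L2) : mean f = ∫ x, f x ∂unitMeasure := rfl

theorem mem_H0_iff {f : L2} : f ∈ H0 ↔ mean f = 0 := Iff.rfl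

/-- The constant function `1` in `L²(0,1)`. -/
noncomputable def one : L2 := Lp.const 2 unitMeasure (1 : ℝ)

theorem coeFn_one : one =ᵐ[unitMeasure] fun _ => 1 := Lp.coeFn_const (p := 2) _ _

theorem mean_one : mean one = 1 := by
  rw [mean_apply, integral_congr_ae coeFn_one]; simp

/-- The projection `f ↦ f - ∫ f` of `L²(0,1)` onto its mean-zero part. -/
noncomputable def proj : L2 →L[ℝ] H0 :=
  (ContinuousLinearMap.id ℝ L2 - mean.smulRight one).codRestrict H0 fun f => by
    simp [mem_H0_iff, mean_one]

theorem coe_proj (f : L2) : (proj f : L2) = f - mean f • one := rfl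

theorem proj_of_mem (f : H0) : proj (f : L2) = f := by
  apply Subtype.ext
  rw [coe_proj, mem_H0_iff.1 f.2, zero_smul, sub_zero]

theorem proj_one : proj one = 0 := by
  apply Subtype.ext
  rw [coe_proj, mean_one, one_smul, sub_self]; rfl

theorem isClosed_H0 : IsClosed (H0 : Set L2) :=
  isClosed_eq mean.continuous continuous_const

instance : CompleteSpace H0 := isClosed_H0.completeSpace_coe

/-! ### The space `𝓦₁⁰` -/

namespace W10

theorem zero_left (q : W10) : q 0 = 0 := q.2.2.2 0 (by simp)

theorem zero_right (q : W10) : q 1 = 0 := q.2.2.2 1 (by simp)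

theorem coeFn_D (q : W10) : D q =ᵐ[unitMeasure] deriv q := q.2.2.1.coeFn_toLp

theorem add_apply (p q : W10) (x : ℝ) : (p + q) x = p x + q x := rfl

theorem smul_apply (c : ℝ) (q : W10) (x : ℝ) : (c • q) x = c * q x := rfl

theorem norm_D (q : W10) : ‖D q‖ = ‖q‖ := rfl

theorem continuous (q : W10) : Continuous (q : ℝ → ℝ) := by
  have h1 : ContinuousOn q (Icc 0 1) := by
    simpa [uIcc_of_le (zero_le_one' ℝ)] using q.2.1.continuousOn
  have h2 : (q : ℝ → ℝ) = fun x => q (max 0 (min 1 x)) := by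
    funext x
    rcases le_or_gt x 0 with h | h
    · rw [q.2.2.2 x (by simp [h]), max_eq_left (by simp [h]), zero_left]
    rcases le_or_gt 1 x with h' | h'
    · rw [q.2.2.2 x (by simp [h']), min_eq_left h', max_eq_right zero_le_one, zero_right]
    · rw [min_eq_right h'.le, max_eq_right h.le]
  rw [h2]
  exact h1.comp_continuous (by fun_prop) fun x => ⟨by simp, by simp⟩

theorem eq_integral_D (q : W10) {x : ℝ} (hx : x ∈ Icc (0 : ℝ) 1) :
    q x = ∫ t in (0 : ℝ)..x, D q t := by
  have hac : AbsolutelyContinuousOnInterval q 0 x := q.2.1.mono (by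
    rw [uIcc_of_le zero_le_one, uIcc_of_le hx.1]
    exact Icc_subset_Icc_right hx.2)
  rw [intervalIntegral_congr_unit (coeFn_D q) hx, hac.integral_deriv_eq_sub, zero_left, sub_zero]

/-- The sup norm is bounded by the norm of `𝓦₁⁰`. -/
theorem abs_apply_le (q : W10) (x : ℝ) : |q x| ≤ ‖q‖ := by
  by_cases hx : x ∈ Ioo (0 : ℝ) 1
  · have hx' := Ioo_subset_Icc_self hx
    rw [eq_integral_D q hx', ← norm_D]
    exact (abs_intervalIntegral_le (L2.integrable _) hx').trans (integral_abs_le_norm _)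
  · rw [q.2.2.2 x hx, abs_zero]; exact norm_nonneg _

theorem mean_D (q : W10) : mean (D q) = 0 := by
  rw [mean_apply, integral_unitMeasure_eq, ← eq_integral_D q (by simp), zero_right]

/-- An absolutely continuous `u` with `u' ∈ L²(0,1)` vanishing at `0` and `1` gives an element
of `𝓦₁⁰`, namely its restriction to `(0,1)` extended by zero. -/
theorem exists_eqOn {u : ℝ → ℝ} (hu : AbsolutelyContinuousOnInterval u 0 1)
    (hd : MemLp (deriv u) 2 unitMeasure) (h0 : u 0 = 0) (h1 : u 1 = 0) :
    ∃ q : W10, EqOn q u (Ioo 0 1) ∧ D q =ᵐ[unitMeasure] deriv u := by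
  have hder : deriv ((Ioo (0 : ℝ) 1).indicator u) =ᵐ[unitMeasure] deriv u := by
    filter_upwards [ae_restrict_mem measurableSet_Ioo] with x hx
    refine Filter.EventuallyEq.deriv_eq ?_
    filter_upwards [isOpen_Ioo.mem_nhds hx] with y hy using indicator_of_mem hy u
  refine ⟨⟨(Ioo (0 : ℝ) 1).indicator u, hu.congr fun x hx => ?_, (memLp_congr_ae hder).2 hd,
    fun x hx => indicator_of_notMem hx u⟩, fun x hx => indicator_of_mem hx u, ?_⟩
  · rw [uIcc_of_le zero_le_one] at hx
    by_cases h : x ∈ Ioo (0 : ℝ) 1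
    · rw [indicator_of_mem h]
    · rw [indicator_of_notMem h]
      rcases eq_or_lt_of_le hx.1 with h' | h'
      · rw [← h', h0]
      · rw [le_antisymm hx.2 (not_lt.1 fun h'' => h ⟨h', h''⟩), h1]
  · exact (coeFn_D _).trans hder

theorem memLp_mul (p q : W10) : MemLp (fun x => p x * q x) 2 unitMeasure :=
  MemLp.of_bound (p.continuous.mul q.continuous).aestronglyMeasurable (‖p‖ * ‖q‖)
    (Filter.Eventually.of_forall fun x => by
      rw [norm_mul]
      exact mul_le_mul (abs_apply_le p x) (abs_apply_le q x) (abs_nonneg _) (norm_nonneg _))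

theorem memLp (q : W10) : MemLp (q : ℝ → ℝ) 2 unitMeasure :=
  MemLp.of_bound q.continuous.aestronglyMeasurable ‖q‖
    (Filter.Eventually.of_forall fun x => abs_apply_le q x)

/-- The inclusion `𝓦₁⁰ → L²(0,1)`. -/
noncomputable def incl : W10 →L[ℝ] L2 :=
  LinearMap.mkContinuous
    { toFun := fun q => (memLp q).toLp q
      map_add' := fun p q => MemLp.toLp_add (memLp p) (memLp q)
      map_smul' := fun c q => MemLp.toLp_const_smul c (memLp q) } 1
    fun q => by
      rw [one_mul]
      refine norm_le_of_ae_abs_le (norm_nonneg q) ?_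
      filter_upwards [(memLp q).coeFn_toLp] with x hx
      exact (congrArg abs hx).trans_le (abs_apply_le q x)

theorem coeFn_incl (q : W10) : incl q =ᵐ[unitMeasure] q := (memLp q).coeFn_toLp

/-- Pointwise multiplication as a continuous bilinear map `𝓦₁⁰ × 𝓦₁⁰ → L²(0,1)`. -/
noncomputable def mulL2 : W10 →L[ℝ] W10 →L[ℝ] L2 :=
  LinearMap.mkContinuous₂
    (LinearMap.mk₂ ℝ (fun p q => (memLp_mul p q).toLp _)
      (fun p p' q => by
        rw [← MemLp.toLp_add]
        exact MemLp.toLp_congr _ _ (.of_forall fun x => by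
          simp [add_apply, add_mul]))
      (fun c p q => by
        rw [← MemLp.toLp_const_smul]
        exact MemLp.toLp_congr _ _ (.of_forall fun x => by
          simp [smul_apply, mul_assoc]))
      (fun p q q' => by
        rw [← MemLp.toLp_add]
        exact MemLp.toLp_congr _ _ (.of_forall fun x => by
          simp [add_apply, mul_add]))
      (fun c p q => by
        rw [← MemLp.toLp_const_smul]
        exact MemLp.toLp_congr _ _ (.of_forall fun x => by
          simp [smul_apply, mul_left_comm]))) 1
    fun p q => by
      rw [one_mul]
      refine norm_le_of_ae_abs_le (by positivity) ?_
      filter_upwards [(memLp_mul p q).coeFn_toLp] with x hx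
      refine (congrArg abs hx).trans_le ?_
      rw [abs_mul]
      exact mul_le_mul (abs_apply_le p x) (abs_apply_le q x) (abs_nonneg _) (norm_nonneg _)

theorem coeFn_mulL2 (p q : W10) : mulL2 p q =ᵐ[unitMeasure] fun x => p x * q x :=
  (memLp_mul p q).coeFn_toLp

theorem mulL2_comm (p q : W10) : mulL2 p q = mulL2 q p := by
  refine Lp.ext ?_
  filter_upwards [coeFn_mulL2 p q, coeFn_mulL2 q p] with x h1 h2
  rw [h1, h2, mul_comm]

/-- The derivative as a continuous linear map `𝓦₁⁰ → L²(0,1)`. -/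
noncomputable def DL : W10 →L[ℝ] L2 := D.mkContinuous 1 fun q => by rw [one_mul, norm_D]

end W10

/-! ### The linear equation `h' + a h = f + m` with zero boundary values -/

/-- The integrating factor `exp (∫₀ˣ a)` of the equation `h' + a h = f`. -/
noncomputable def intFactor (a : ℝ → ℝ) (x : ℝ) : ℝ := Real.exp (∫ t in (0 : ℝ)..x, a t)

theorem intFactor_pos (a : ℝ → ℝ) (x : ℝ) : 0 < intFactor a x := Real.exp_pos _

section

variable {a : ℝ → ℝ}

theorem hasDerivAt_intFactor (ha : Continuous a) (x : ℝ) :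
    HasDerivAt (intFactor a) (intFactor a x * a x) x :=
  (ha.integral_hasStrictDerivAt 0 x).hasDerivAt.exp

theorem contDiff_intFactor (ha : Continuous a) : ContDiff ℝ 1 (intFactor a) := by
  have hc : Continuous (intFactor a) :=
    continuous_iff_continuousAt.2 fun x => (hasDerivAt_intFactor ha x).continuousAt
  rw [contDiff_one_iff_deriv]
  refine ⟨fun x => (hasDerivAt_intFactor ha x).differentiableAt, ?_⟩
  rw [funext fun x => (hasDerivAt_intFactor ha x).deriv]
  exact hc.mul ha

theorem intFactor_bounds {A : ℝ} (hA : ∀ x, |a x| ≤ A) {x : ℝ} (hx : x ∈ Icc (0 : ℝ) 1) :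
    Real.exp (-A) ≤ intFactor a x ∧ intFactor a x ≤ Real.exp A := by
  have h0 : 0 ≤ A := (abs_nonneg _).trans (hA 0)
  have h1 : |∫ t in (0 : ℝ)..x, a t| ≤ A := by
    have := intervalIntegral.norm_integral_le_of_norm_le_const (a := 0) (b := x) (f := a) (C := A)
      fun t _ => hA t
    rw [sub_zero, abs_of_nonneg hx.1] at this
    exact this.trans (mul_le_of_le_one_right h0 hx.2)
  exact ⟨Real.exp_le_exp.2 (abs_le.1 h1).1, Real.exp_le_exp.2 (abs_le.1 h1).2⟩

theorem integrable_mul_of_continuous {E : ℝ → ℝ} (hE : Continuous E) {f : ℝ → ℝ}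
    (hf : Integrable f unitMeasure) : Integrable (fun x => E x * f x) unitMeasure := by
  have h := (intervalIntegrable_of_integrable hf).continuousOn_mul (g := E) hE.continuousOn
  exact (intervalIntegrable_iff_integrableOn_Ioo_of_le zero_le_one).1 h

theorem integral_intFactor_mul_add_const (ha : Continuous a) (f : L2) (m : ℝ) :
    ∫ t in (0 : ℝ)..1, intFactor a t * (f t + m) =
      (∫ t in (0 : ℝ)..1, intFactor a t * f t) + (∫ t in (0 : ℝ)..1, intFactor a t) * m := by
  have hEc := (contDiff_intFactor ha).continuous
  rw [← intervalIntegral.integral_mul_const, ← intervalIntegral.integral_add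
    (intervalIntegrable_of_integrable (integrable_mul_of_continuous hEc (L2.integrable f)))
    ((hEc.mul_const m).intervalIntegrable _ _)]
  exact intervalIntegral.integral_congr fun t _ => mul_add _ _ _

/-- The solution formula for `h' + a h = f`, `h(0) = 0`. -/
theorem intFactor_mul_eq_integral (ha : Continuous a) {h : W10} {f : ℝ → ℝ}
    (hode : W10.D h =ᵐ[unitMeasure] fun x => f x - a x * h x) {x : ℝ}
    (hx : x ∈ Icc (0 : ℝ) 1) :
    intFactor a x * h x = ∫ t in (0 : ℝ)..x, intFactor a t * f t := by
  have hac : AbsolutelyContinuousOnInterval (intFactor a * (h : ℝ → ℝ)) 0 1 :=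
    ((contDiff_intFactor ha).contDiffOn.absolutelyContinuousOnInterval).mul h.2.1
  have hac' := hac.mono (c := 0) (d := x) (by
    rw [uIcc_of_le zero_le_one, uIcc_of_le hx.1]
    exact Icc_subset_Icc_right hx.2)
  have key := hac'.integral_deriv_eq_sub
  simp only [Pi.mul_apply, h.zero_left, mul_zero, sub_zero] at key
  rw [← key]
  refine intervalIntegral_congr_unit ?_ hx
  filter_upwards [ae_diff h.2.1, W10.coeFn_D h, hode] with t h1 h2 h3
  rw [((hasDerivAt_intFactor ha t).mul h1.hasDerivAt).deriv, ← h2, h3]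
  ring

theorem integral_intFactor_ge {A : ℝ} (ha : Continuous a) (hA : ∀ x, |a x| ≤ A) :
    Real.exp (-A) ≤ ∫ t in (0 : ℝ)..1, intFactor a t := by
  have h := intervalIntegral.integral_mono_on (a := 0) (b := 1) (μ := volume) zero_le_one
    (f := fun _ => Real.exp (-A)) (g := intFactor a) (by simp)
    ((contDiff_intFactor ha).continuous.intervalIntegrable _ _)
    fun x hx => (intFactor_bounds hA hx).1
  simpa using h

theorem abs_integral_intFactor_mul_le {A : ℝ} (ha : Continuous a) (hA : ∀ x, |a x| ≤ A)
    (f : L2) {x : ℝ} (hx : x ∈ Icc (0 : ℝ) 1) :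
    |∫ t in (0 : ℝ)..x, intFactor a t * f t| ≤ Real.exp A * ‖f‖ := by
  have hi := integrable_mul_of_continuous (contDiff_intFactor ha).continuous (L2.integrable f)
  refine (abs_intervalIntegral_le hi hx).trans ?_
  calc ∫ t, |intFactor a t * f t| ∂unitMeasure
      ≤ ∫ t, Real.exp A * |f t| ∂unitMeasure := by
        refine integral_mono_ae hi.abs ((L2.integrable f).abs.const_mul _) ?_
        filter_upwards [ae_restrict_mem measurableSet_Ioo] with t ht
        rw [abs_mul, abs_of_pos (intFactor_pos a t)]
        exact mul_le_mul_of_nonneg_right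
          (intFactor_bounds hA (Ioo_subset_Icc_self ht)).2 (abs_nonneg _)
    _ ≤ Real.exp A * ‖f‖ := by
        rw [integral_const_mul]
        exact mul_le_mul_of_nonneg_left (integral_abs_le_norm f) (Real.exp_pos _).le

/-- The solution of `h' + a h = f + m` is controlled by `f` alone: the boundary condition at `1`
bounds the constant `m`. -/
theorem norm_le_of_ode {A : ℝ} (ha : Continuous a) (hA : ∀ x, |a x| ≤ A) {h : W10} {f : L2}
    {m : ℝ} (hode : W10.D h =ᵐ[unitMeasure] fun x => f x + m - a x * h x) :
    ‖h‖ ≤ (1 + Real.exp (2 * A)) * (1 + A * Real.exp (2 * A)) * ‖f‖ := by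
  have hA0 : 0 ≤ A := (abs_nonneg _).trans (hA 0)
  have hEc := (contDiff_intFactor ha).continuous
  have e2 : Real.exp (2 * A) = Real.exp A * Real.exp A := by rw [two_mul, Real.exp_add]
  have ee : Real.exp A * Real.exp (-A) = 1 := by rw [← Real.exp_add]; simp
  have hpos := Real.exp_pos A
  -- the constant `m` is determined by evaluating the solution formula at the right end point
  have hm : |m| ≤ Real.exp (2 * A) * ‖f‖ := by
    have h1 := intFactor_mul_eq_integral (f := fun x => f x + m) ha hode (x := 1) (by simp)
    rw [h.zero_right, mul_zero, integral_intFactor_mul_add_const ha] at h1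
    have h2 := abs_integral_intFactor_mul_le ha hA f (x := 1) (by simp)
    have h3 := integral_intFactor_ge ha hA
    have h4 : |m| * Real.exp (-A) ≤ Real.exp A * ‖f‖ := by
      calc |m| * Real.exp (-A) ≤ |m| * ∫ t in (0 : ℝ)..1, intFactor a t :=
            mul_le_mul_of_nonneg_left h3 (abs_nonneg _)
        _ = |(∫ t in (0 : ℝ)..1, intFactor a t) * m| := by
            rw [abs_mul, abs_of_nonneg ((Real.exp_pos _).le.trans h3), mul_comm]
        _ = |∫ t in (0 : ℝ)..1, intFactor a t * f t| := by
            rw [← abs_neg]; congr 1; linarith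
        _ ≤ _ := h2
    calc |m| = Real.exp A * (|m| * Real.exp (-A)) := by linear_combination -|m| * ee
      _ ≤ Real.exp A * (Real.exp A * ‖f‖) := mul_le_mul_of_nonneg_left h4 hpos.le
      _ = _ := by rw [e2]; ring
  set F : L2 := f + m • one with hF
  have hFae : F =ᵐ[unitMeasure] fun x => f x + m := by
    filter_upwards [Lp.coeFn_add f (m • one), Lp.coeFn_smul m one, coeFn_one] with x h1 h2 h3
    rw [h1, Pi.add_apply, h2, Pi.smul_apply, h3]; simp
  have hone : ‖one‖ ≤ 1 := norm_le_of_ae_abs_le zero_le_one (by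
    filter_upwards [coeFn_one] with x hx
    rw [hx]; simp)
  have hFn : ‖F‖ ≤ (1 + Real.exp (2 * A)) * ‖f‖ := by
    calc ‖F‖ ≤ ‖f‖ + |m| * ‖one‖ := (norm_add_le _ _).trans_eq (by rw [norm_smul]; rfl)
      _ ≤ ‖f‖ + |m| * 1 := by gcongr
      _ ≤ _ := by linarith
  have hode' : W10.D h =ᵐ[unitMeasure] fun x => F x - a x * h x := by
    filter_upwards [hode, hFae] with x h1 h2
    rw [h1, h2]
  have hsup : ∀ x ∈ Icc (0 : ℝ) 1, |h x| ≤ Real.exp (2 * A) * ‖F‖ := by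
    intro x hx
    have h1 := intFactor_mul_eq_integral ha hode' hx
    have h2 := abs_integral_intFactor_mul_le ha hA F hx
    rw [← h1, abs_mul, abs_of_pos (intFactor_pos a x)] at h2
    have h3 := mul_le_mul_of_nonneg_right (intFactor_bounds hA hx).1 (abs_nonneg (h x))
    calc |h x| = Real.exp A * (Real.exp (-A) * |h x|) := by linear_combination -|h x| * ee
      _ ≤ Real.exp A * (Real.exp A * ‖F‖) := mul_le_mul_of_nonneg_left (h3.trans h2) hpos.le
      _ = _ := by rw [e2]; ring
  have hdiff : ‖W10.D h - F‖ ≤ A * (Real.exp (2 * A) * ‖F‖) := by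
    refine norm_le_of_ae_abs_le (by positivity) ?_
    filter_upwards [Lp.coeFn_sub (W10.D h) F, hode', ae_restrict_mem measurableSet_Ioo]
      with x h1 h2 h3
    rw [h1, Pi.sub_apply, h2, sub_sub_cancel_left, abs_neg, abs_mul]
    exact mul_le_mul (hA x) (hsup x (Ioo_subset_Icc_self h3)) (abs_nonneg _) hA0
  calc ‖h‖ = ‖F + (W10.D h - F)‖ := by rw [add_sub_cancel, W10.norm_D]
    _ ≤ ‖F‖ + A * (Real.exp (2 * A) * ‖F‖) := (norm_add_le _ _).trans (by gcongr)
    _ = (1 + A * Real.exp (2 * A)) * ‖F‖ := by ring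
    _ ≤ (1 + A * Real.exp (2 * A)) * ((1 + Real.exp (2 * A)) * ‖f‖) := by gcongr
    _ = _ := by ring

/-- For a suitable constant `m` the solution of `h' + a h = f + m`, `h(0) = 0`, also vanishes
at `1`. -/
theorem exists_ode_solution {A : ℝ} (ha : Continuous a) (hA : ∀ x, |a x| ≤ A) (f : L2) :
    ∃ (h : W10) (m : ℝ), W10.D h =ᵐ[unitMeasure] fun x => f x + m - a x * h x := by
  have hEc := (contDiff_intFactor ha).continuous
  have hI : 0 < ∫ t in (0 : ℝ)..1, intFactor a t :=
    (Real.exp_pos _).trans_le (integral_intFactor_ge ha hA)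
  -- `m` makes the integral of `intFactor a * (f + m)` over `(0,1)` vanish
  set m : ℝ := -(∫ t in (0 : ℝ)..1, intFactor a t * f t) / ∫ t in (0 : ℝ)..1, intFactor a t
    with hm
  have hint : IntervalIntegrable (fun t => intFactor a t * (f t + m)) volume 0 1 :=
    intervalIntegrable_of_integrable
      (integrable_mul_of_continuous hEc ((L2.integrable f).add (integrable_const m)))
  set V : ℝ → ℝ := fun x => ∫ t in (0 : ℝ)..x, intFactor a t * (f t + m) with hV
  have hV1 : V 1 = 0 := by
    simp only [hV]
    rw [integral_intFactor_mul_add_const ha, hm, mul_div_cancel₀ _ hI.ne', add_neg_cancel]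
  have hVac : AbsolutelyContinuousOnInterval V 0 1 :=
    hint.absolutelyContinuousOnInterval_intervalIntegral (by simp)
  have hEinv : ContDiff ℝ 1 fun x => (intFactor a x)⁻¹ :=
    (contDiff_intFactor ha).inv fun x => (intFactor_pos a x).ne'
  set u : ℝ → ℝ := (fun x => (intFactor a x)⁻¹) * V with hu
  have huac : AbsolutelyContinuousOnInterval u 0 1 :=
    hEinv.contDiffOn.absolutelyContinuousOnInterval.mul hVac
  have hder : deriv u =ᵐ[unitMeasure] fun x => f x + m - a x * u x := by
    refine (ae_restrict_iff' measurableSet_Ioo).2 ?_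
    filter_upwards [hint.ae_hasDerivAt_integral] with x hx hx'
    have h1 : HasDerivAt V (intFactor a x * (f x + m)) x :=
      hx (by rw [uIcc_of_le zero_le_one]; exact Ioo_subset_Icc_self hx') 0 (by simp)
    have hne := (intFactor_pos a x).ne'
    have h2 : HasDerivAt u _ x := ((hasDerivAt_intFactor ha x).inv hne).mul h1
    rw [h2.deriv]
    simp only [hu, Pi.mul_apply, Pi.inv_apply]
    field_simp
    ring
  have hmem : MemLp (deriv u) 2 unitMeasure := by
    refine (memLp_congr_ae hder).2 (((Lp.memLp f).add (memLp_const m)).sub ?_)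
    obtain ⟨C, hC⟩ := huac.exists_bound
    rw [uIcc_of_le zero_le_one] at hC
    have hcont : ContinuousOn (fun x => a x * u x) (Ioo 0 1) :=
      ha.continuousOn.mul (huac.continuousOn.mono (by
        rw [uIcc_of_le zero_le_one]; exact Ioo_subset_Icc_self))
    refine MemLp.of_bound (hcont.aestronglyMeasurable measurableSet_Ioo) (A * C) ?_
    filter_upwards [ae_restrict_mem measurableSet_Ioo] with x hx
    rw [norm_mul]
    exact mul_le_mul (hA x) (hC x (Ioo_subset_Icc_self hx)) (norm_nonneg _)
      ((abs_nonneg _).trans (hA 0))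
  obtain ⟨h, hh, hD⟩ := W10.exists_eqOn huac hmem (by simp [hu, hV]) (by simp [hu, hV1])
  refine ⟨h, m, ?_⟩
  filter_upwards [hD, hder, ae_restrict_mem measurableSet_Ioo] with x h1 h2 h3
  rw [h1, h2, hh h3]

end

/-! ### The linearized curvature map -/

/-- The linear operator `h ↦ 2 h' + 8 (q₀ + p) h - ∫₀¹ 8 (q₀ + p) h`. It is the derivative of the
curvature map at `p`, and also its difference quotient between two points with midpoint `p`. -/
noncomputable def linOp (q₀ : ℝ) (p : W10) : W10 →L[ℝ] H0 :=
  proj.comp ((2 : ℝ) • W10.DL + (8 * q₀) • W10.incl + (8 : ℝ) • W10.mulL2 p)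

theorem linOp_ae (q₀ : ℝ) (p h : W10) :
    ((2 : ℝ) • W10.DL + (8 * q₀) • W10.incl + (8 : ℝ) • W10.mulL2 p) h =ᵐ[unitMeasure]
      fun x => 2 * W10.D h x + 2 * (4 * (q₀ + p x)) * h x := by
  change ⇑((2 : ℝ) • W10.D h + (8 * q₀) • W10.incl h + (8 : ℝ) • W10.mulL2 p h) =ᵐ[_] _
  filter_upwards [Lp.coeFn_add ((2 : ℝ) • W10.D h + (8 * q₀) • W10.incl h)
    ((8 : ℝ) • W10.mulL2 p h), Lp.coeFn_add ((2 : ℝ) • W10.D h) ((8 * q₀) • W10.incl h),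
    Lp.coeFn_smul (2 : ℝ) (W10.D h), Lp.coeFn_smul (8 * q₀) (W10.incl h),
    Lp.coeFn_smul (8 : ℝ) (W10.mulL2 p h), W10.coeFn_incl h, W10.coeFn_mulL2 p h]
    with x h1 h2 h3 h4 h5 h6 h7
  rw [h1, Pi.add_apply, h2, Pi.add_apply, h3, h4, h5]
  simp only [Pi.smul_apply, smul_eq_mul]
  rw [h6, h7]
  ring

theorem continuous_coeff (q₀ : ℝ) (p : W10) : Continuous fun x => 4 * (q₀ + p x) :=
  continuous_const.mul (continuous_const.add p.continuous)

theorem abs_coeff_le (q₀ : ℝ) {p : W10} {R : ℝ} (hp : ‖p‖ ≤ R) (x : ℝ) :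
    |4 * (q₀ + p x)| ≤ 4 * (|q₀| + R) := by
  rw [abs_mul, abs_of_pos (by norm_num : (0 : ℝ) < 4)]
  have h1 := abs_add_le q₀ (p x)
  have h2 := (p.abs_apply_le x).trans hp
  linarith

/-- The operators `linOp q₀ p` are bounded below uniformly for `p` in a ball. -/
theorem exists_norm_le_linOp (q₀ R : ℝ) :
    ∃ C : ℝ, 0 < C ∧ ∀ p : W10, ‖p‖ ≤ R → ∀ h : W10, ‖h‖ ≤ C * ‖linOp q₀ p h‖ := by
  rcases lt_or_ge R 0 with hR | hR
  · exact ⟨1, one_pos, fun p hp => absurd ((norm_nonneg p).trans hp) (not_le.2 hR)⟩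
  set A := 4 * (|q₀| + R) with hA
  have hA0 : 0 ≤ A := by positivity
  refine ⟨(1 + Real.exp (2 * A)) * (1 + A * Real.exp (2 * A)), by positivity, fun p hp h => ?_⟩
  set T := ((2 : ℝ) • W10.DL + (8 * q₀) • W10.incl + (8 : ℝ) • W10.mulL2 p) h with hT
  have hg : linOp q₀ p h = proj T := rfl
  have hcoe := coe_proj T
  rw [← hg] at hcoe
  have hbound := norm_le_of_ode (continuous_coeff q₀ p) (abs_coeff_le q₀ hp) (h := h)
    (f := (2⁻¹ : ℝ) • (linOp q₀ p h : L2)) (m := mean T / 2) ?_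
  · refine hbound.trans (mul_le_mul_of_nonneg_left ?_ (by positivity))
    rw [norm_smul, Submodule.coe_norm]
    exact mul_le_of_le_one_left (norm_nonneg _) (by norm_num)
  · rw [hcoe]
    filter_upwards [Lp.coeFn_smul (2⁻¹ : ℝ) (T - mean T • one), Lp.coeFn_sub T (mean T • one),
      Lp.coeFn_smul (mean T) one, coeFn_one, linOp_ae q₀ p h] with x h1 h2 h3 h4 h5
    rw [h1, Pi.smul_apply, h2, Pi.sub_apply, h3, Pi.smul_apply, h4, h5]
    simp only [smul_eq_mul]
    ring

theorem linOp_injective (q₀ : ℝ) (p : W10) : Function.Injective (linOp q₀ p) := by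
  obtain ⟨C, -, hC⟩ := exists_norm_le_linOp q₀ ‖p‖
  rw [injective_iff_map_eq_zero]
  intro h hh
  have := hC p le_rfl h
  rw [hh, norm_zero, mul_zero] at this
  exact norm_le_zero_iff.1 this

theorem linOp_surjective (q₀ : ℝ) (p : W10) : Function.Surjective (linOp q₀ p) := by
  intro g
  obtain ⟨h, m, hm⟩ := exists_ode_solution (continuous_coeff q₀ p) (abs_coeff_le q₀ le_rfl)
    ((2⁻¹ : ℝ) • (g : L2))
  refine ⟨h, ?_⟩
  have hT : ((2 : ℝ) • W10.DL + (8 * q₀) • W10.incl + (8 : ℝ) • W10.mulL2 p) h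
      = (g : L2) + (2 * m) • one := by
    refine Lp.ext ?_
    filter_upwards [linOp_ae q₀ p h, hm, Lp.coeFn_smul (2⁻¹ : ℝ) (g : L2),
      Lp.coeFn_add (g : L2) ((2 * m) • one), Lp.coeFn_smul (2 * m) one, coeFn_one]
      with x h1 h2 h3 h4 h5 h6
    rw [h1, h2, h3, h4, Pi.add_apply, h5, Pi.smul_apply, Pi.smul_apply, h6]
    simp only [smul_eq_mul]
    ring
  refine (congrArg proj hT).trans ?_
  rw [ map_add, map_smul, proj_one, smul_zero, add_zero, proj_of_mem]

/-! ### The curvature map -/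

/-- The curvature map `q ↦ 2 q' + 8 q₀ q + 4 q² - 𝒦₀`, the constant `𝒦₀` being the mean value of
the other terms. -/
noncomputable def curvMap (q₀ : ℝ) (q : W10) : H0 :=
  proj ((2 : ℝ) • W10.D q + (8 * q₀) • W10.incl q + (4 : ℝ) • W10.mulL2 q q)

theorem curvMap_arg_ae (q₀ : ℝ) (q : W10) :
    ⇑((2 : ℝ) • W10.D q + (8 * q₀) • W10.incl q + (4 : ℝ) • W10.mulL2 q q) =ᵐ[unitMeasure]
      fun x => 2 * deriv q x + 4 * (2 * q₀ * q x + q x ^ 2) := by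
  filter_upwards [Lp.coeFn_add ((2 : ℝ) • W10.D q + (8 * q₀) • W10.incl q)
    ((4 : ℝ) • W10.mulL2 q q), Lp.coeFn_add ((2 : ℝ) • W10.D q) ((8 * q₀) • W10.incl q),
    Lp.coeFn_smul (2 : ℝ) (W10.D q), Lp.coeFn_smul (8 * q₀) (W10.incl q),
    Lp.coeFn_smul (4 : ℝ) (W10.mulL2 q q), W10.coeFn_incl q, W10.coeFn_mulL2 q q, W10.coeFn_D q]
    with x h1 h2 h3 h4 h5 h6 h7 h8
  rw [h1, Pi.add_apply, h2, Pi.add_apply, h3, h4, h5]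
  simp only [Pi.smul_apply, smul_eq_mul]
  rw [h6, h7, h8]
  ring

theorem mean_curvMap_arg (q₀ : ℝ) (q : W10) :
    mean ((2 : ℝ) • W10.D q + (8 * q₀) • W10.incl q + (4 : ℝ) • W10.mulL2 q q) = K0 q₀ q := by
  rw [map_add, map_add, map_smul, W10.mean_D, smul_zero, zero_add, ← map_add, mean_apply, K0,
    ← intervalIntegral.integral_const_mul, ← integral_unitMeasure_eq]
  refine integral_congr_ae ?_
  filter_upwards [Lp.coeFn_add ((8 * q₀) • W10.incl q) ((4 : ℝ) • W10.mulL2 q q),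
    Lp.coeFn_smul (8 * q₀) (W10.incl q),
    Lp.coeFn_smul (4 : ℝ) (W10.mulL2 q q), W10.coeFn_incl q, W10.coeFn_mulL2 q q]
    with x h1 h2 h3 h4 h5
  rw [h1, Pi.add_apply, h2, h3]
  simp only [Pi.smul_apply, smul_eq_mul]
  rw [h4, h5]
  ring

theorem curvMap_ae (q₀ : ℝ) (q : W10) :
    ⇑(curvMap q₀ q : L2) =ᵐ[unitMeasure]
      fun x => 2 * deriv q x + 4 * (q₀ + q x) ^ 2 - K0 q₀ q - 4 * q₀ ^ 2 := by
  rw [curvMap, coe_proj, mean_curvMap_arg]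
  set T := (2 : ℝ) • W10.D q + (8 * q₀) • W10.incl q + (4 : ℝ) • W10.mulL2 q q with hT
  filter_upwards [curvMap_arg_ae q₀ q, Lp.coeFn_sub T (K0 q₀ q • one),
    Lp.coeFn_smul (K0 q₀ q) one, coeFn_one] with x h1 h2 h3 h4
  rw [h2, Pi.sub_apply, h3, Pi.smul_apply, h4, hT, h1]
  simp only [smul_eq_mul]
  ring

theorem hasDerivAt_profile (r₀ q₀ : ℝ) (q : W10) (x : ℝ) :
    HasDerivAt (profile r₀ q₀ q) (2 * (q₀ + q x) * profile r₀ q₀ q x) x := by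
  have hc : Continuous fun t => q₀ + q t := continuous_const.add q.continuous
  have h := ((((hc.integral_hasStrictDerivAt 0 x).hasDerivAt).const_mul 2).exp).const_mul r₀
  refine h.congr_deriv ?_
  simp only [profile]
  ring

theorem gaussianCurvature_profile {r₀ : ℝ} (hr : 0 < r₀) (q₀ : ℝ) (q : W10) {x : ℝ}
    (hx : DifferentiableAt ℝ q x) :
    gaussianCurvature (profile r₀ q₀ q) x = -(2 * deriv q x + 4 * (q₀ + q x) ^ 2) := by
  have h1 : deriv (profile r₀ q₀ q) = fun y => 2 * (q₀ + q y) * profile r₀ q₀ q y :=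
    funext fun y => (hasDerivAt_profile r₀ q₀ q y).deriv
  have h2 : HasDerivAt (fun y => 2 * (q₀ + q y) * profile r₀ q₀ q y) _ x :=
    ((hx.hasDerivAt.const_add q₀).const_mul 2).mul (hasDerivAt_profile r₀ q₀ q x)
  have h3 : profile r₀ q₀ q x ≠ 0 := (mul_pos hr (Real.exp_pos _)).ne'
  rw [gaussianCurvature, h1, h2.deriv]
  field_simp
  ring

/-- A quadratic map has difference quotients equal to its derivative at the midpoint. -/
theorem curvMap_sub (q₀ : ℝ) (p q : W10) :
    curvMap q₀ p - curvMap q₀ q = linOp q₀ ((2⁻¹ : ℝ) • (p + q)) (p - q) := by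
  rw [curvMap, curvMap, ← map_sub]
  refine congrArg proj ?_
  change _ = (2 : ℝ) • W10.D (p - q) + (8 * q₀) • W10.incl (p - q) +
    (8 : ℝ) • W10.mulL2 ((2⁻¹ : ℝ) • (p + q)) (p - q)
  have h : (8 : ℝ) • W10.mulL2 ((2⁻¹ : ℝ) • (p + q)) (p - q) =
      (4 : ℝ) • (W10.mulL2 p p - W10.mulL2 q q) := by
    rw [map_smul, smul_apply, smul_smul, map_add,
      add_apply, map_sub, map_sub, W10.mulL2_comm q p]
    norm_num
  rw [h, map_sub, map_sub]
  module

theorem analyticOnNhd_curvMap (q₀ : ℝ) : AnalyticOnNhd ℝ (curvMap q₀) univ := by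
  intro q _
  have h1 : AnalyticAt ℝ (fun q : W10 => W10.mulL2 q q) q :=
    (W10.mulL2.analyticAt_bilinear (q, q)).comp₂ analyticAt_id analyticAt_id
  have h3 : AnalyticAt ℝ (fun q : W10 => (4 : ℝ) • W10.mulL2 q q) q :=
    (analyticAt_const (v := (4 : ℝ))).smul h1
  have h2 : AnalyticAt ℝ (fun q : W10 => ((2 : ℝ) • W10.DL + (8 * q₀) • W10.incl) q +
      (4 : ℝ) • W10.mulL2 q q) q :=
    (ContinuousLinearMap.analyticAt _ q).add h3
  exact (proj.analyticAt _).comp h2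

theorem hasFDerivAt_curvMap (q₀ : ℝ) (q : W10) :
    HasFDerivAt (curvMap q₀) (linOp q₀ q) q := by
  have h1 : HasFDerivAt (fun q : W10 => W10.mulL2 q q) _ q :=
    W10.mulL2.hasFDerivAt_of_bilinear (hasFDerivAt_id q) (hasFDerivAt_id q)
  have h2 : HasFDerivAt (fun q : W10 => ((2 : ℝ) • W10.DL + (8 * q₀) • W10.incl) q +
      (4 : ℝ) • W10.mulL2 q q) _ q :=
    (ContinuousLinearMap.hasFDerivAt _).add (h1.const_smul (4 : ℝ))
  have h3 : HasFDerivAt (curvMap q₀) _ q := proj.hasFDerivAt.comp q h2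
  refine h3.congr_fderiv (ContinuousLinearMap.ext fun h => ?_)
  refine congrArg proj ?_
  change (2 : ℝ) • W10.D h + (8 * q₀) • W10.incl h +
    (4 : ℝ) • (W10.mulL2 q h + W10.mulL2 h q) =
    (2 : ℝ) • W10.D h + (8 * q₀) • W10.incl h + (8 : ℝ) • W10.mulL2 q h
  rw [W10.mulL2_comm h q]
  module

theorem curvMap_injective (q₀ : ℝ) : Function.Injective (curvMap q₀) := by
  intro p q h
  have h1 := curvMap_sub q₀ p q
  rw [h, sub_self] at h1
  exact sub_eq_zero.1 (linOp_injective q₀ _ (h1.symm.trans (map_zero _).symm))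

-- `linOp 0 0 : 𝓦₁⁰ → 𝓗₀` is onto and bounded below, so completeness of `𝓗₀` carries over.
instance : CompleteSpace W10 := by
  obtain ⟨C, hC0, hC⟩ := exists_norm_le_linOp 0 0
  have hanti : AntilipschitzWith ⟨C, hC0.le⟩ (linOp 0 0) :=
    (linOp 0 0).antilipschitz_of_bound fun h => hC 0 (by simp) h
  refine (hanti.isUniformInducing (linOp 0 0).uniformContinuous).completeSpace ?_
  rw [(linOp_surjective 0 0).range_eq]
  exact completeSpace_iff_isComplete_univ.1 inferInstance

/-! ### The energy identity and the range of the curvature map -/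

namespace W10

theorem inner_D_eq_integral (f : L2) (q : W10) {g : ℝ → ℝ} (hg : f =ᵐ[unitMeasure] g) :
    inner ℝ f (D q) = ∫ x in (0 : ℝ)..1, g x * deriv q x := by
  rw [L2.inner_def, ← integral_unitMeasure_eq]
  refine integral_congr_ae ?_
  filter_upwards [hg, coeFn_D q] with x h1 h2
  rw [h1, h2, real_inner_eq_re_inner, mul_comm]
  simp [mul_comm]

theorem inner_one_D (q : W10) : inner ℝ one (D q) = 0 := by
  rw [inner_D_eq_integral _ _ coeFn_one]
  simp only [one_mul]
  rw [q.2.1.integral_deriv_eq_sub, zero_left, zero_right, sub_zero]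

theorem inner_incl_D (q : W10) : inner ℝ (incl q) (D q) = 0 := by
  rw [inner_D_eq_integral _ _ (coeFn_incl q)]
  have h := q.2.1.integral_mul_deriv_eq_deriv_mul q.2.1
  simp only [mul_comm (deriv _ _), zero_left, zero_right, mul_zero, sub_zero, zero_sub] at h
  linarith

theorem inner_mulL2_D (q : W10) : inner ℝ (mulL2 q q) (D q) = 0 := by
  rw [inner_D_eq_integral _ _ (coeFn_mulL2 q q)]
  have h := ((q.2.1.mul q.2.1).mul q.2.1).integral_deriv_eq_sub
  simp only [Pi.mul_apply, zero_left, zero_right, mul_zero, sub_zero] at h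
  have h2 : ∫ x in (0 : ℝ)..1, deriv ((q : ℝ → ℝ) * (q : ℝ → ℝ) * (q : ℝ → ℝ)) x =
      ∫ x in (0 : ℝ)..1, 3 * (q x * q x * deriv q x) := by
    refine intervalIntegral_congr_unit ?_ (by simp)
    filter_upwards [ae_diff q.2.1] with x hx
    rw [((hx.hasDerivAt.mul hx.hasDerivAt).mul hx.hasDerivAt).deriv]
    simp only [Pi.mul_apply]
    ring
  rw [h2, intervalIntegral.integral_const_mul] at h
  linarith

end W10

/-- The a priori bound `2 ‖q‖ ≤ ‖G q‖`, from `⟪G q, q'⟫ = 2 ‖q'‖²`. -/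
theorem two_mul_norm_le_norm_curvMap (q₀ : ℝ) (q : W10) : 2 * ‖q‖ ≤ ‖curvMap q₀ q‖ := by
  have h1 : inner ℝ (curvMap q₀ q : L2) (W10.D q) = 2 * ‖q‖ ^ 2 := by
    rw [curvMap, coe_proj, inner_sub_left, inner_add_left, inner_add_left, inner_smul_left,
      inner_smul_left, inner_smul_left, inner_smul_left, W10.inner_one_D, W10.inner_incl_D,
      W10.inner_mulL2_D, real_inner_self_eq_norm_sq, W10.norm_D]
    simp
  have h2 := real_inner_le_norm (curvMap q₀ q : L2) (W10.D q)
  rw [h1, W10.norm_D] at h2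
  rcases (norm_nonneg q).eq_or_lt with h | h
  · rw [← h, mul_zero]; exact norm_nonneg _
  · refine le_of_mul_le_mul_right ?_ h
    calc 2 * ‖q‖ * ‖q‖ = 2 * ‖q‖ ^ 2 := by ring
      _ ≤ _ := h2

/-- If `G qₙ` converges, the a priori bound puts all midpoints `(qₘ + qₙ) / 2` in one ball, where
`linOp` is uniformly bounded below; hence `qₙ` is a Cauchy sequence. -/
theorem isClosed_range_curvMap (q₀ : ℝ) : IsClosed (range (curvMap q₀)) := by
  refine isClosed_of_closure_subset fun y hy => ?_
  obtain ⟨z, hz, hlim⟩ := mem_closure_iff_seq_limit.1 hy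
  choose q hq using hz
  obtain ⟨B, hB⟩ := (Metric.isBounded_range_of_tendsto z hlim).exists_norm_le
  have hR : ∀ n, ‖q n‖ ≤ B := fun n => by
    have h1 := two_mul_norm_le_norm_curvMap q₀ (q n)
    rw [hq] at h1
    have h2 := hB (z n) (mem_range_self n)
    have h3 := norm_nonneg (q n)
    linarith
  obtain ⟨C, hC0, hC⟩ := exists_norm_le_linOp q₀ B
  have hcauchy : CauchySeq q := by
    have hzc := hlim.cauchySeq
    rw [Metric.cauchySeq_iff] at hzc ⊢
    intro ε hε
    obtain ⟨N, hN⟩ := hzc (ε / C) (by positivity)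
    refine ⟨N, fun m hm n hn => ?_⟩
    have hmid : ‖(2⁻¹ : ℝ) • (q m + q n)‖ ≤ B := by
      rw [norm_smul]
      have := (norm_add_le (q m) (q n)).trans (add_le_add (hR m) (hR n))
      norm_num
      linarith
    have h1 := hC _ hmid (q m - q n)
    rw [← curvMap_sub, hq, hq, ← dist_eq_norm, ← dist_eq_norm] at h1
    calc dist (q m) (q n) ≤ C * dist (z m) (z n) := h1
      _ < C * (ε / C) := mul_lt_mul_of_pos_left (hN m hm n hn) hC0
      _ = ε := by field_simp
  obtain ⟨p, hp⟩ := cauchySeq_tendsto_of_complete hcauchy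
  refine ⟨p, tendsto_nhds_unique ?_ hlim⟩
  have := ((hasFDerivAt_curvMap q₀ p).continuousAt.tendsto).comp hp
  exact this.congr hq

/-- The derivative of the curvature map as a continuous linear equivalence. -/
noncomputable def linEquiv (q₀ : ℝ) (q : W10) : W10 ≃L[ℝ] H0 :=
  ContinuousLinearEquiv.ofBijective (linOp q₀ q) (LinearMap.ker_eq_bot.2 (linOp_injective q₀ q))
    (LinearMap.range_eq_top.2 (linOp_surjective q₀ q))

theorem hasFDerivAt_curvMap_equiv (q₀ : ℝ) (q : W10) :
    HasFDerivAt (curvMap q₀) (linEquiv q₀ q : W10 →L[ℝ] H0) q :=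
  hasFDerivAt_curvMap q₀ q

theorem isOpen_range_curvMap (q₀ : ℝ) : IsOpen (range (curvMap q₀)) := by
  refine (isOpenMap_of_hasStrictFDerivAt_equiv (f' := linEquiv q₀) fun q => ?_).isOpen_range
  have h := (analyticOnNhd_curvMap q₀ q trivial).hasStrictFDerivAt
  rwa [(hasFDerivAt_curvMap_equiv q₀ q).fderiv] at h

theorem curvMap_surjective (q₀ : ℝ) : Function.Surjective (curvMap q₀) :=
  range_eq_univ.1 <| IsClopen.eq_univ ⟨isClosed_range_curvMap q₀, isOpen_range_curvMap q₀⟩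
    (range_nonempty _)

theorem isRealAnalyticIso_curvMap (q₀ : ℝ) : IsRealAnalyticIso (curvMap q₀) := by
  let e := Equiv.ofBijective (curvMap q₀) ⟨curvMap_injective q₀, curvMap_surjective q₀⟩
  refine ⟨analyticOnNhd_curvMap q₀, e.symm, e.left_inv, e.right_inv, fun y _ => ?_⟩
  obtain ⟨q, rfl⟩ := curvMap_surjective q₀ y
  -- the exponent `⊤` of `WithTop ℕ∞` is `ω`: analytic
  have hc : ContDiffAt ℝ ⊤ (curvMap q₀) q :=
    (analyticOnNhd_curvMap q₀ q trivial).contDiffAt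
  have hd := hasFDerivAt_curvMap_equiv q₀ q
  have hne : (⊤ : WithTop ℕ∞) ≠ 0 := by simp
  have hinv := (hc.to_localInverse hd hne).analyticAt
  refine hinv.congr ?_
  have hs := hc.hasStrictFDerivAt' hd hne
  filter_upwards [hs.eventually_right_inverse] with z hz
  exact (e.symm_apply_eq.2 hz.symm).symm

end Revolution

theorem theorem1p4 (q₀ : ℝ) :
    ∃ G : Revolution.W10 → Revolution.H0,
      -- `G(q) = -𝒦 - 𝒦₀ - 4 q₀²`, with `𝒦` the Gaussian curvature of the profile of `q`
      (∀ r₀ : ℝ, 0 < r₀ → ∀ q : Revolution.W10,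
        ⇑(G q : Revolution.L2) =ᵐ[Revolution.unitMeasure] fun x =>
          -Revolution.gaussianCurvature (Revolution.profile r₀ q₀ q) x
            - Revolution.K0 q₀ q - 4 * q₀ ^ 2) ∧
      (∀ q : Revolution.W10, ⇑(G q : Revolution.L2) =ᵐ[Revolution.unitMeasure] fun x =>
        2 * deriv q x + 4 * (q₀ + q x) ^ 2 - Revolution.K0 q₀ q - 4 * q₀ ^ 2) ∧
      Revolution.IsRealAnalyticIso G ∧
      -- `𝒦₀` is uniquely determined by `G(q)`
      (∃! k : Revolution.H0 → ℝ, ∀ q : Revolution.W10, k (G q) = Revolution.K0 q₀ q) := by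
  open Revolution in
  refine ⟨curvMap q₀, fun r₀ hr q => ?_, curvMap_ae q₀, isRealAnalyticIso_curvMap q₀, ?_⟩
  · filter_upwards [curvMap_ae q₀ q, ae_diff q.2.1] with x h1 h2
    rw [h1, gaussianCurvature_profile hr q₀ q h2, neg_neg]
  · have hinv := Function.leftInverse_invFun (curvMap_injective q₀)
    refine ⟨fun f => K0 q₀ (Function.invFun (curvMap q₀) f), fun q => ?_, fun k hk => ?_⟩
    · exact congrArg (K0 q₀) (hinv q)
    · funext f
      obtain ⟨q, rfl⟩ := curvMap_surjective q₀ f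
      exact (hk q).trans (congrArg (K0 q₀) (hinv q)).symm
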